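/- For even integers $k\ge 2$ let $B_k$ be the $k$-th Bernoulli number and let $$E_k := 1-\frac{2k}{B_k}\sum_{n\ge 1}\sigma_{k-1}(n)\,q^n ,\qquad \sigma_{k-1}(n)=\sum_{d\mid n}d^{k-1},$$ and put $E_0:=1$. For integers $m\ge 1$, $\alpha\ge 0$ and $0\le r\le m-1$ let $$H(m,\alpha,r):=(-1)^{m+1+r}\binom{\alpha-1-r}{m-1-r}\binom{\alpha}{r},$$ where $\binom{x}{j}=x(x-1)\cdots(x-j+1)/j!$ for every integer $x$ and every integer $j\ge 0$; thus $H(m,\alpha,r)=0$ for $r>\alpha$. For a prime $p$ let $\mathbb Z_{(p)}$ be the ring of $p$-integral rational numbers. For power series $f,g\in\mathbb Q[\![q]\!]$, write $f\equiv g\pmod{p^m}$ if $f,g\in\mathbb Z_{(p)}[\![q]\!]$ and every coefficient of $f-g$ lies in $p^m\mathbb Z_{(p)}$. **Theorem.** Let $p\ge 5$ be prime, and let $m$ and $\alpha$ be integers with $1\le m\le p-1$ and $\alpha\ge 1$. Then $$E_{\alpha(p-1)}\equiv\sum_{r=0}^{m-1}H(m,\alpha,r)\,E_{r(p-1)}\,E_{p-1}^{\alpha-r}\pmod{p^m}.$$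 -/

import Mathlib

noncomputable section

namespace EisensteinCongruence

open PowerSeries

/-- The Fourier expansion, in `ℚ⟦q⟧`, of the normalized Eisenstein series
`E_k = 1 - (2k / B_k) ∑_{n ≥ 1} σ_{k-1}(n) q^n`, with the convention `E_0 = 1`.
It is meant for even `k`. -/
def eisE (k : ℕ) : ℚ⟦X⟧ :=
  if k = 0 then 1
  else PowerSeries.mk fun n =>
    if n = 0 then 1
    else -(2 * (k : ℚ) / bernoulli k) * (ArithmeticFunction.sigma (k - 1) n : ℚ)

/-- For even `k ≥ 4`, `eisE k` is the `q`-expansion of Mathlib's normalized Eisenstein series of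
weight `k` and level one. -/
theorem qExpansion_eq_map_eisE {k : ℕ} (hk : 3 ≤ k) (hk2 : Even k) :
    UpperHalfPlane.qExpansion 1 (ModularForm.E hk)
      = (eisE k).map (algebraMap ℚ ℂ) := by
  have hk0 : k ≠ 0 := by omega
  ext n
  rw [EisensteinSeries.E_qExpansion_coeff hk hk2 n, PowerSeries.coeff_map]
  simp only [eisE, hk0, if_false, PowerSeries.coeff_mk]
  split_ifs <;> simp

/-- `H(m, α, r) = (-1)^(m+1+r) * binom(α-1-r, m-1-r) * binom(α, r)` for `0 ≤ r ≤ m - 1`.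
The upper entry `α - 1 - r` is an integer which may be negative, so the first factor is the
generalized binomial coefficient `x (x-1) ⋯ (x-j+1) / j!`. -/
def H (m α r : ℕ) : ℤ :=
  (-1) ^ (m + 1 + r) * Ring.choose ((α : ℤ) - 1 - r) (m - 1 - r) * (α.choose r : ℤ)

/-- The coefficient `H(m, α, r)` vanishes for `r > α`; so in a sum of terms
`H(m, α, r) F_r f ^ (α - r)` negative exponents of `f` never matter. -/
theorem H_eq_zero_of_lt {m α r : ℕ} (h : α < r) : H m α r = 0 := by
  simp [H, Nat.choose_eq_zero_of_lt h]

/-- `x` lies in the ring `ℤ_(p)` of `p`-integral rational numbers. -/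
def IsPIntegral (p : ℕ) (x : ℚ) : Prop := ¬ p ∣ x.den

/-- `f ≡ g (mod p^m)` for power series: both `f` and `g` lie in `ℤ_(p)⟦q⟧`, and corresponding
coefficients are congruent modulo `p^m ℤ_(p)`. -/
def CongMod (p m : ℕ) (f g : ℚ⟦X⟧) : Prop :=
  ∀ n : ℕ, IsPIntegral p (coeff n f) ∧ IsPIntegral p (coeff n g) ∧
    ∃ c : ℚ, IsPIntegral p c ∧ coeff n f - coeff n g = (p : ℚ) ^ m * c

end EisensteinCongruence

end

/-! The sequence `r ↦ E_{r(p-1)}` behaves like a polynomial `p`-adically: for `j ≤ p - 1` its `j`-th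
differences lie in `p^j ℤ_(p)⟦q⟧` (`diffDiv_eisE`). Since `E_{p-1} ≡ 1 (mod p)`, the powers of its
inverse share this property, hence so does `E_{r(p-1)} / E_{p-1}^r`. Newton's interpolation formula,
cut off at order `m`, expresses the value at `α` modulo `p^m` by those at `0, …, m - 1`, with
coefficients `H` (`DiffDiv.eq_sum_H_smul`). Multiplying by `E_{p-1}^α` gives the theorem.

For `k = r(p-1)`, the differences of `p(1 - p^(k-1))B_k` are controlled by writing it as the sum
over `0 < a < p` of `(pX + a)^k` evaluated umbrally at `X^i ↦ B_i`. As `(pX + a)^(p-1) = 1 + pG`,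
differencing produces powers of `pG`, and von Staudt–Clausen bounds the denominators. This works up
to order `p - 2`; the factor `pr` in `2k/B_k` supplies the last order. -/

noncomputable section

namespace EisensteinCongruence

/-! ### Sequences with divisible differences, and truncated Newton interpolation. -/

section DividedDifferences

variable {A : Type*} [CommRing A]

/-- `DiffDiv R π M f` says that `f` takes values in the subring `R` and that for every `j ≤ M` the
`j`-th forward difference of `f` takes values in `π ^ j R`. -/
def DiffDiv (R : Subring A) (π : A) : ℕ → (ℕ → A) → Prop
  | 0, f => ∀ s, f s ∈ R
  | M + 1, f => (∀ s, f s ∈ R) ∧ ∃ g, DiffDiv R π M g ∧ ∀ s, f (s + 1) - f s = π * g s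

namespace DiffDiv

variable {R : Subring A} {π : A} {M : ℕ} {f g : ℕ → A}

theorem mem (h : DiffDiv R π M f) (s : ℕ) : f s ∈ R := by
  cases M with
  | zero => exact h s
  | succ M => exact h.1 s

theorem of_succ (h : DiffDiv R π (M + 1) f) : DiffDiv R π M f := by
  induction M generalizing f with
  | zero => exact h.1
  | succ M ih =>
    obtain ⟨h1, g, hg, hfg⟩ := h
    exact ⟨h1, g, ih hg, hfg⟩

theorem mono {N : ℕ} (h : DiffDiv R π M f) (hN : N ≤ M) : DiffDiv R π N f := by
  induction hN with
  | refl => exact h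
  | step _ ih => exact ih h.of_succ

theorem const {c : A} (hc : c ∈ R) (M : ℕ) : DiffDiv R π M fun _ => c := by
  induction M generalizing c with
  | zero => exact fun _ => hc
  | succ M ih => exact ⟨fun _ => hc, fun _ => 0, ih R.zero_mem, by simp⟩

theorem add (hf : DiffDiv R π M f) (hg : DiffDiv R π M g) : DiffDiv R π M fun s => f s + g s := by
  induction M generalizing f g with
  | zero => exact fun s => R.add_mem (hf s) (hg s)
  | succ M ih =>
    obtain ⟨hf1, f', hf', hff⟩ := hf
    obtain ⟨hg1, g', hg', hgg⟩ := hg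
    exact ⟨fun s => R.add_mem (hf1 s) (hg1 s), _, ih hf' hg',
      fun s => by linear_combination hff s + hgg s⟩

theorem sum {ι : Type*} (t : Finset ι) {F : ι → ℕ → A} (h : ∀ i ∈ t, DiffDiv R π M (F i)) :
    DiffDiv R π M fun s => ∑ i ∈ t, F i s := by
  classical
  induction t using Finset.induction_on with
  | empty => simpa using const R.zero_mem M
  | insert a t ha ih =>
    simp only [Finset.sum_insert ha]
    exact (h a (by simp)).add (ih fun i hi => h i (by simp [hi]))

theorem shift (hf : DiffDiv R π M f) : DiffDiv R π M fun s => f (s + 1) := by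
  induction M generalizing f with
  | zero => exact fun s => hf _
  | succ M ih =>
    obtain ⟨hf1, f', hf', hff⟩ := hf
    exact ⟨fun s => hf1 _, _, ih hf', fun s => hff _⟩

theorem mul (hf : DiffDiv R π M f) (hg : DiffDiv R π M g) : DiffDiv R π M fun s => f s * g s := by
  induction M generalizing f g with
  | zero => exact fun s => R.mul_mem (hf s) (hg s)
  | succ M ih =>
    have hf0 := hf.of_succ.shift
    have hg0 := hg.of_succ
    obtain ⟨hf1, f', hf', hff⟩ := hf
    obtain ⟨hg1, g', hg', hgg⟩ := hg
    exact ⟨fun s => R.mul_mem (hf1 s) (hg1 s), _, (ih hf' hg0).add (ih hf0 hg'),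
      fun s => by linear_combination g s * hff s + f (s + 1) * hgg s⟩

/-- From `Δg(s) = -g(s) g(s+1) Δf(s)`, where `g` is needed only to one order less. -/
theorem of_mul_eq_one (hf : DiffDiv R π M f) (hg : ∀ s, g s ∈ R) (hfg : ∀ s, f s * g s = 1) :
    DiffDiv R π M g := by
  induction M generalizing f with
  | zero => exact hg
  | succ M ih =>
    have hg0 := ih hf.of_succ hfg
    obtain ⟨hf1, f', hf', hff⟩ := hf
    refine ⟨hg, _, ((const (R.neg_mem R.one_mem) M).mul hf').mul (hg0.mul hg0.shift), fun s => ?_⟩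
    linear_combination (-g s * g (s + 1)) * hff s - g (s + 1) * hfg s + g s * hfg (s + 1)

/-- One order is gained because `Δ(s f(s)) = s Δf(s) + f(s+1)`, and the outer `π` pays for this
difference. -/
theorem natCast_mul (hπ : π ∈ R) (hf : DiffDiv R π M f) :
    DiffDiv R π (M + 1) fun s => π * (s * f s) := by
  have key : ∀ {f : ℕ → A}, (∀ s, f s ∈ R) → ∀ s : ℕ, π * (s * f s) ∈ R := fun h s =>
    R.mul_mem hπ (R.mul_mem (natCast_mem R s) (h s))
  induction M generalizing f with
  | zero =>
    refine ⟨key hf.mem, fun s => (s + 1 : ℕ) * f (s + 1) - s * f s, fun s => ?_, fun s => by ring⟩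
    exact R.sub_mem (R.mul_mem (natCast_mem R _) (hf _)) (R.mul_mem (natCast_mem R _) (hf _))
  | succ M ih =>
    have hf0 := hf.shift
    obtain ⟨hf1, f', hf', hff⟩ := hf
    refine ⟨key hf1, _, (ih hf').add hf0, fun s => ?_⟩
    push_cast
    linear_combination (π * s) * hff s

theorem of_pow_mul (hπ : π ∈ R) (hg : ∀ s, g s ∈ R) (hfg : ∀ s, f s = π ^ M * g s) :
    DiffDiv R π M f := by
  have hf : ∀ s, f s ∈ R := fun s => hfg s ▸ R.mul_mem (R.pow_mem hπ M) (hg s)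
  induction M generalizing f g with
  | zero => exact hf
  | succ M ih =>
    have h1 : ∀ s, g (s + 1) - g s ∈ R := fun s => R.sub_mem (hg _) (hg _)
    refine ⟨hf, fun s => π ^ M * (g (s + 1) - g s), ih h1 (fun _ => rfl)
      (fun s => R.mul_mem (R.pow_mem hπ M) (h1 s)), fun s => ?_⟩
    rw [hfg, hfg]
    ring

theorem pow {x y : A} (hx : x ∈ R) (hy : y ∈ R) (hxy : x = 1 + π * y) (M : ℕ) :
    DiffDiv R π M fun s => x ^ s := by
  induction M with
  | zero => exact fun s => R.pow_mem hx s
  | succ M ih =>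
    refine ⟨fun s => R.pow_mem hx s, _, (const hy M).mul ih, fun s => ?_⟩
    simp only [pow_succ]
    linear_combination x ^ s * hxy

theorem fwdDiff_iter_eq (h : DiffDiv R π M f) (i s : ℕ) :
    ∃ c ∈ R, (fwdDiff 1)^[M + i] f s = π ^ M * c := by
  induction M generalizing f with
  | zero =>
    refine ⟨(fwdDiff 1)^[i] f s, ?_, by simp⟩
    rw [fwdDiff_iter_eq_sum_shift]
    exact R.sum_mem fun k _ => R.zsmul_mem (h.mem _) _
  | succ M ih =>
    obtain ⟨hf1, f', hf', hff⟩ := h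
    obtain ⟨c, hc, hc'⟩ := ih hf'
    refine ⟨c, hc, ?_⟩
    have : fwdDiff 1 f = π • f' := by
      ext s
      exact hff s
    rw [show M + 1 + i = (M + i) + 1 by ring, Function.iterate_succ_apply, this,
      fwdDiff_iter_const_smul, Pi.smul_apply, hc', smul_eq_mul]
    ring

end DiffDiv

/-- Since `C(α,j) C(j,r) = C(α,r) C(α-r,j-r)`, this is a truncated alternating sum of binomials,
which telescopes by Pascal's rule. At `r = α` the upper entry is `-1`, so Pascal's rule is used for
generalized binomials. -/
theorem sum_choose_mul_choose_eq_H (m α r : ℕ) (hr : r < m) :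
    ∑ j ∈ Finset.range m, ((α.choose j : ℤ) * ((-1) ^ (j - r) * (j.choose r : ℤ))) = H m α r := by
  obtain ⟨i, rfl⟩ := Nat.exists_eq_add_of_lt hr
  induction i with
  | zero =>
    rw [Finset.sum_range_succ, Finset.sum_eq_zero]
    · simp [H, pow_mul, show r + 1 + 1 + r = 2 * (r + 1) by ring]
    · intro j hj
      simp [Nat.choose_eq_zero_of_lt (Finset.mem_range.1 hj)]
  | succ i ih =>
    rw [show r + (i + 1) + 1 = (r + i + 1) + 1 by ring, Finset.sum_range_succ, ih (by omega)]
    rcases lt_or_ge α r with h | h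
    · rw [H_eq_zero_of_lt h, H_eq_zero_of_lt h, Nat.choose_eq_zero_of_lt (by omega)]
      simp
    · have h1 : α.choose (r + i + 1) * (r + i + 1).choose r = α.choose r * (α - r).choose (i + 1) := by
        rcases lt_or_ge α (r + i + 1) with h' | h'
        · rw [Nat.choose_eq_zero_of_lt h', Nat.choose_eq_zero_of_lt (by omega : α - r < i + 1)]
          simp
        · rw [Nat.choose_mul (by omega), show r + i + 1 - r = i + 1 by omega]
      have h2 : ((α - r).choose (i + 1) : ℤ)
          = Ring.choose ((α : ℤ) - 1 - r) i + Ring.choose ((α : ℤ) - 1 - r) (i + 1) := by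
        rw [← Ring.choose_succ_succ, ← Ring.choose_natCast (R := ℤ), Nat.cast_sub h]
        congr 1
        ring
      have h3 : ((α.choose (r + i + 1) : ℤ) * (r + i + 1).choose r)
          = α.choose r * (α - r).choose (i + 1) := by exact_mod_cast h1
      have h4 : ∀ j, (-1 : ℤ) ^ (r + j + 1 + 1 + r) = (-1) ^ j := fun j => by
        rw [show r + j + 1 + 1 + r = 2 * (r + 1) + j by ring, pow_add, pow_mul]
        simp
      rw [show r + i + 1 - r = i + 1 by omega]
      simp only [H]
      rw [show r + i + 1 + 1 = r + (i + 1) + 1 by ring, show r + i + 1 - 1 - r = i by omega,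
        show r + (i + 1) + 1 - 1 - r = i + 1 by omega, h4, show r + i + 1 = r + (i + 1) by ring] at *
      have h5 := h4 i
      rw [show r + i + 1 + 1 + r = r + (i + 1) + 1 + r by ring] at h5
      rw [h5, pow_succ]
      linear_combination (-(-1) ^ i) * h3 - (-1) ^ i * (α.choose r : ℤ) * h2

theorem DiffDiv.eq_sum_H_smul {R : Subring A} {π : A} {m : ℕ} {f : ℕ → A}
    (hf : DiffDiv R π m f) (α : ℕ) :
    ∃ c ∈ R, f α - ∑ r ∈ Finset.range m, H m α r • f r = π ^ m * c := by
  -- Newton's formula padded with zero terms, so that it can be split at `m` even when `α < m`.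
  have h1 : f α = ∑ j ∈ Finset.range (m + (α + 1)), α.choose j • (fwdDiff 1)^[j] f 0 := by
    have := shift_eq_sum_fwdDiff_iter 1 f α 0
    rw [zero_add, smul_eq_mul, mul_one] at this
    rw [this]
    refine Finset.sum_subset (fun x => by simp; omega) fun j _ hj => ?_
    rw [Nat.choose_eq_zero_of_lt (by simpa using hj), zero_smul]
  have h2 : ∑ j ∈ Finset.range m, α.choose j • (fwdDiff 1)^[j] f 0
      = ∑ r ∈ Finset.range m, H m α r • f r := by
    have h3 : ∀ j ∈ Finset.range m, α.choose j • (fwdDiff 1)^[j] f 0 = ∑ r ∈ Finset.range m,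
        ((α.choose j : ℤ) * ((-1) ^ (j - r) * (j.choose r : ℤ))) • f r := fun j hj => by
      rw [fwdDiff_iter_eq_sum_shift, Finset.smul_sum]
      have hj := Finset.mem_range.1 hj
      refine Finset.sum_subset_zero_on_sdiff (fun x => by simp; omega) (fun x hx => ?_)
        fun x hx => ?_
      · have : j < x := by simpa using (Finset.mem_sdiff.1 hx).2
        simp [Nat.choose_eq_zero_of_lt this]
      · simp only [zero_add, smul_eq_mul, mul_one, nsmul_eq_mul, zsmul_eq_mul]
        push_cast
        ring
    rw [Finset.sum_congr rfl h3, Finset.sum_comm]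
    refine Finset.sum_congr rfl fun r hr => ?_
    rw [← Finset.sum_smul, sum_choose_mul_choose_eq_H m α r (Finset.mem_range.1 hr)]
  choose c hc hc' using fun i => hf.fwdDiff_iter_eq i 0
  refine ⟨∑ i ∈ Finset.range (α + 1), α.choose (m + i) • c i,
    R.sum_mem fun i _ => R.nsmul_mem (hc i) _, ?_⟩
  rw [h1, Finset.sum_range_add, h2, add_sub_cancel_left, Finset.mul_sum]
  refine Finset.sum_congr rfl fun i _ => ?_
  rw [hc', mul_smul_comm]

end DividedDifferences

/-! ### `p`-integrality of Bernoulli numbers. -/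

section PIntegral

variable (p : ℕ) [hp : Fact p.Prime]

/-- The ring `ℤ_(p)` of `p`-integral rational numbers. -/
def pIntegral : Subring ℚ where
  carrier := {x | IsPIntegral p x}
  mul_mem' {x y} hx hy h :=
    (hp.out.dvd_mul.1 (h.trans (Rat.mul_den_dvd x y))).elim hx hy
  one_mem' := by simpa [IsPIntegral] using hp.out.one_lt.ne'
  add_mem' {x y} hx hy h :=
    (hp.out.dvd_mul.1 (h.trans (Rat.add_den_dvd x y))).elim hx hy
  zero_mem' := by simpa [IsPIntegral] using hp.out.one_lt.ne'
  neg_mem' {x} hx := by simpa [IsPIntegral] using hx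

variable {p}

theorem mem_pIntegral {x : ℚ} : x ∈ pIntegral p ↔ IsPIntegral p x := Iff.rfl

theorem intCast_div_mem_pIntegral (a : ℤ) {b : ℤ} (hb : ¬ (p : ℤ) ∣ b) :
    (a / b : ℚ) ∈ pIntegral p := by
  rw [mem_pIntegral, IsPIntegral, ← Rat.divInt_eq_div]
  exact fun h => hb ((Int.natCast_dvd_natCast.2 h).trans (Rat.den_dvd a b))

theorem inv_natCast_mem_pIntegral {d : ℕ} (hd : ¬ p ∣ d) : (d : ℚ)⁻¹ ∈ pIntegral p := by
  simpa using intCast_div_mem_pIntegral 1 (mt Int.natCast_dvd_natCast.1 hd)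

theorem one_add_mul_ne_zero_and_inv_mem {c : ℚ} (hc : c ∈ pIntegral p) :
    1 + p * c ≠ 0 ∧ (1 + p * c)⁻¹ ∈ pIntegral p := by
  have hd : (c.den : ℚ) ≠ 0 := by exact_mod_cast c.den_ne_zero
  have hb : ¬ (p : ℤ) ∣ c.den + p * c.num := fun h =>
    hc (Int.natCast_dvd_natCast.1 ((Int.dvd_add_left (dvd_mul_right _ _)).1 h))
  have hb0 : (c.den + p * c.num : ℚ) ≠ 0 := by
    intro h
    apply hb
    rw [show (c.den + p * c.num : ℤ) = 0 by exact_mod_cast h]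
    exact dvd_zero _
  have key : 1 + p * c = (c.den + p * c.num) / c.den := by
    conv_lhs => rw [← Rat.num_div_den c]
    field_simp
  rw [key]
  refine ⟨div_ne_zero hb0 hd, ?_⟩
  rw [inv_div]
  simpa using intCast_div_mem_pIntegral (c.den : ℤ) hb

theorem mul_bernoulli_mem_and_bernoulli_mem (i : ℕ) (h2 : p ≠ 2) :
    p * bernoulli i ∈ pIntegral p ∧ (i < p - 1 → bernoulli i ∈ pIntegral p) := by
  have hmul {x : ℚ} (hx : x ∈ pIntegral p) : p * x ∈ pIntegral p :=
    (pIntegral p).mul_mem (natCast_mem _ p) hx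
  have hinv {q : ℕ} (hq : q.Prime) (hqp : q ≠ p) : (1 / q : ℚ) ∈ pIntegral p := by
    rw [one_div]
    exact inv_natCast_mem_pIntegral fun h => hqp ((Nat.prime_dvd_prime_iff_eq hp.out hq).1 h).symm
  have of_mem (h : bernoulli i ∈ pIntegral p) :
      p * bernoulli i ∈ pIntegral p ∧ (i < p - 1 → bernoulli i ∈ pIntegral p) :=
    ⟨hmul h, fun _ => h⟩
  rcases Nat.even_or_odd' i with ⟨k, rfl | rfl⟩
  · rcases Nat.eq_zero_or_pos k with rfl | hk
    · exact of_mem (by simp [(pIntegral p).one_mem])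
    obtain ⟨z, hz⟩ := Bernoulli.vonStaudt_clausen k
    have hB := eq_sub_of_add_eq hz.symm
    constructor
    · rw [hB, mul_sub, Finset.mul_sum]
      refine (pIntegral p).sub_mem (hmul (intCast_mem _ z))
        ((pIntegral p).sum_mem fun q hq => ?_)
      by_cases hqp : q = p
      · have : (p : ℚ) ≠ 0 := by exact_mod_cast hp.out.ne_zero
        rw [hqp, mul_one_div_cancel this]
        exact (pIntegral p).one_mem
      · exact hmul (hinv (by simp at hq; tauto) hqp)
    · intro hlt
      rw [hB]
      refine (pIntegral p).sub_mem (intCast_mem _ z) ((pIntegral p).sum_mem fun q hq => ?_)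
      refine hinv (by simp at hq; tauto) ?_
      rintro rfl
      have : q - 1 ∣ 2 * k := by simp at hq; tauto
      exact absurd (Nat.le_of_dvd (by omega) this) (by omega)
  · rcases Nat.eq_zero_or_pos k with rfl | hk
    · refine of_mem ?_
      have := intCast_div_mem_pIntegral (p := p) (-1) (b := 2) (by
        intro h
        exact h2 ((Nat.prime_dvd_prime_iff_eq hp.out Nat.prime_two).1 (by exact_mod_cast h)))
      simpa using this
    · exact of_mem (by
        rw [bernoulli_eq_zero_of_odd ⟨k, rfl⟩ (by omega)]; exact (pIntegral p).zero_mem)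

theorem mul_bernoulli_mem_pIntegral (h2 : p ≠ 2) (i : ℕ) : p * bernoulli i ∈ pIntegral p :=
  (mul_bernoulli_mem_and_bernoulli_mem i h2).1

theorem bernoulli_mem_pIntegral (h2 : p ≠ 2) {i : ℕ} (hi : i < p - 1) :
    bernoulli i ∈ pIntegral p :=
  (mul_bernoulli_mem_and_bernoulli_mem i h2).2 hi

end PIntegral

/-! ### Umbral calculus for Bernoulli numbers. -/

section BernoulliFunctional

open Polynomial hiding bernoulli sum_bernoulli

/-- The linear functional on `ℚ[X]` which sends `X ^ i` to the `i`-th Bernoulli number. -/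
def bernoulliFunctional : ℚ[X] →ₗ[ℚ] ℚ :=
  Polynomial.lsum fun i => bernoulli i • LinearMap.id

theorem bernoulliFunctional_apply (f : ℚ[X]) :
    bernoulliFunctional f = f.sum fun i c => bernoulli i * c := by
  simp [bernoulliFunctional]

@[simp]
theorem bernoulliFunctional_X_pow (i : ℕ) : bernoulliFunctional (X ^ i) = bernoulli i := by
  rw [bernoulliFunctional_apply, ← one_mul (X ^ i), ← C_1, C_mul_X_pow_eq_monomial,
    sum_monomial_index] <;> simp

theorem map_X_add_one_pow (N : ℚ[X] →ₗ[ℚ] ℚ) (k : ℕ) :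
    N ((X + 1) ^ k) = ∑ i ∈ Finset.range k, (k.choose i : ℚ) * N (X ^ i) + N (X ^ k) := by
  rw [add_pow, Finset.sum_range_succ, map_add, map_sum]
  congr 1
  · refine Finset.sum_congr rfl fun i _ => ?_
    rw [one_pow, mul_one, mul_comm, ← C_eq_natCast, ← smul_eq_C_mul, map_smul, smul_eq_mul]
  · simp

theorem bernoulliFunctional_comp_X_add_one (f : ℚ[X]) :
    bernoulliFunctional (f.comp (X + 1)) = bernoulliFunctional f + f.derivative.eval 0 := by
  induction f using Polynomial.induction_on' with
  | add f g hf hg =>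
    rw [add_comp, map_add, map_add, hf, hg, derivative_add, eval_add]
    ring
  | monomial n c =>
    rw [← C_mul_X_pow_eq_monomial, mul_comp, C_comp, X_pow_comp, ← smul_eq_C_mul, ← smul_eq_C_mul,
      map_smul, map_smul, map_X_add_one_pow, derivative_smul, eval_smul, ← smul_add]
    simp only [bernoulliFunctional_X_pow, sum_bernoulli]
    congr 1
    rw [add_comm, add_right_inj]
    rcases n with _ | _ | n <;> simp

/-- Invariance on `X^(k+1)` gives `(k+1) N(X^k)` plus lower terms equal to zero, so induction
applies. -/
theorem eq_zero_of_map_comp_X_add_one (N : ℚ[X] →ₗ[ℚ] ℚ)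
    (hN : ∀ f : ℚ[X], N (f.comp (X + 1)) = N f) (f : ℚ[X]) : N f = 0 := by
  have key : ∀ k, N (X ^ k) = 0 := fun k => by
    induction k using Nat.strong_induction_on with
    | _ k ih =>
      have h := hN (X ^ (k + 1))
      rw [X_pow_comp, map_X_add_one_pow, add_eq_right, Finset.sum_range_succ,
        Finset.sum_eq_zero fun i hi => by rw [ih i (Finset.mem_range.1 hi), mul_zero],
        zero_add, mul_eq_zero] at h
      refine h.resolve_left ?_
      simp [Nat.cast_add_one_ne_zero]
  induction f using Polynomial.induction_on' with
  | add f g hf hg => rw [map_add, hf, hg, add_zero]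
  | monomial n c =>
    rw [← C_mul_X_pow_eq_monomial, ← smul_eq_C_mul, map_smul, key, smul_zero]

/-- The multiplication theorem for Bernoulli polynomials, in terms of `bernoulliFunctional`. -/
theorem sum_bernoulliFunctional_comp (n : ℕ) (f : ℚ[X]) :
    ∑ a ∈ Finset.range n, bernoulliFunctional (f.comp ((n : ℚ[X]) * X + (a : ℚ[X])))
      = n * bernoulliFunctional f := by
  let N : ℚ[X] →ₗ[ℚ] ℚ :=
    ∑ a ∈ Finset.range n,
      bernoulliFunctional ∘ₗ (aeval ((n : ℚ[X]) * X + (a : ℚ[X]))).toLinearMap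
    - (n : ℚ) • bernoulliFunctional
  have hN : ∀ f, N f = ∑ a ∈ Finset.range n,
      bernoulliFunctional (f.comp ((n : ℚ[X]) * X + (a : ℚ[X]))) - n * bernoulliFunctional f :=
    fun f => by simp [N, LinearMap.sum_apply, comp_eq_aeval]
  rw [← sub_eq_zero, ← hN]
  -- Under `X ↦ X + 1` the sum telescopes to a change of `n f'(0)`, the same as that of the
  -- right-hand side.
  refine eq_zero_of_map_comp_X_add_one N (fun f => ?_) f
  rw [hN, hN]
  have h1 : ∀ a : ℕ, (f.comp (X + 1)).comp ((n : ℚ[X]) * X + (a : ℚ[X]))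
      = f.comp ((n : ℚ[X]) * X + ((a + 1 : ℕ) : ℚ[X])) := fun a => by
    rw [comp_assoc]
    simp [add_assoc]
  have h2 := Finset.sum_range_sub
    (fun a : ℕ => bernoulliFunctional (f.comp ((n : ℚ[X]) * X + (a : ℚ[X])))) n
  have h3 := bernoulliFunctional_comp_X_add_one (f.comp ((n : ℚ[X]) * X))
  have h4 : (f.comp ((n : ℚ[X]) * X)).comp (X + 1) = f.comp ((n : ℚ[X]) * X + (n : ℚ[X])) := by
    rw [comp_assoc]
    simp [mul_add]
  have h5 : (f.comp ((n : ℚ[X]) * X)).derivative.eval 0 = n * f.derivative.eval 0 := by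
    simp [derivative_comp, eval_comp]
  rw [h4, h5] at h3
  simp only [Nat.cast_zero, add_zero, Finset.sum_sub_distrib] at h2
  simp only [h1]
  rw [bernoulliFunctional_comp_X_add_one]
  linear_combination h2 + h3

end BernoulliFunctional

/-! ### Kummer-type congruences for `p(1 - p^(k-1))B_k`. -/

section KummerCongruences

open Polynomial hiding bernoulli sum_bernoulli

variable {p : ℕ} [hp : Fact p.Prime]

theorem bernoulliFunctional_map_mem_pIntegral (h2 : p ≠ 2) {f : ℤ[X]}
    (hf : (f.map (Int.castRingHom (ZMod p))).natDegree < p - 1) :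
    bernoulliFunctional (f.map (Int.castRingHom ℚ)) ∈ pIntegral p := by
  rw [bernoulliFunctional_apply, sum_def]
  refine (pIntegral p).sum_mem fun i _ => ?_
  rw [coeff_map, eq_intCast]
  rcases lt_or_ge i (p - 1) with hi | hi
  · exact (pIntegral p).mul_mem (bernoulli_mem_pIntegral h2 hi) (intCast_mem _ _)
  · have h0 := coeff_eq_zero_of_natDegree_lt (hf.trans_le hi)
    rw [coeff_map, eq_intCast, ZMod.intCast_zmod_eq_zero_iff_dvd] at h0
    obtain ⟨c, hc⟩ := h0
    rw [hc, show bernoulli i * ((p * c : ℤ) : ℚ) = p * bernoulli i * c by push_cast; ring]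
    exact (pIntegral p).mul_mem (mul_bernoulli_mem_pIntegral h2 i) (intCast_mem _ _)

/-- Fermat handles the constant term; terms of degree at least 2 in `pX` carry `p^2`, so they vanish
modulo `p` in `G`. -/
theorem exists_pow_sub_one_eq_one_add_mul {a : ℕ} (ha : ¬ p ∣ a) :
    ∃ G : ℤ[X], ((p : ℤ[X]) * X + (a : ℤ[X])) ^ (p - 1) = 1 + (p : ℤ[X]) * G ∧
      (G.map (Int.castRingHom (ZMod p))).natDegree ≤ 1 := by
  obtain ⟨k, hk⟩ := powAddExpansion (a : ℤ[X]) ((p : ℤ[X]) * X) (p - 1)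
  obtain ⟨c, hc⟩ : (p : ℤ) ∣ (a : ℤ) ^ (p - 1) - 1 := by
    rw [← ZMod.intCast_zmod_eq_zero_iff_dvd]
    push_cast
    rw [ZMod.pow_card_sub_one_eq_one (by rwa [Ne, ZMod.natCast_eq_zero_iff]), sub_self]
  have hc' : (a : ℤ[X]) ^ (p - 1) - 1 = (p : ℤ[X]) * C c := by
    simpa using congrArg (C : ℤ → ℤ[X]) hc
  refine ⟨C c + (((p - 1 : ℕ) : ℤ[X]) * (a : ℤ[X]) ^ (p - 1 - 1)) * X + (p : ℤ[X]) * (k * X ^ 2), ?_, ?_⟩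
  · rw [add_comm, hk]
    linear_combination hc'
  · simp only [Polynomial.map_add, Polynomial.map_mul, Polynomial.map_natCast, Polynomial.map_pow,
      map_X, map_C, CharP.cast_eq_zero, zero_mul, add_zero]
    rw [← C_eq_natCast, ← C_eq_natCast, ← C_pow, ← C_mul]
    compute_degree

/-- Differencing in `s` replaces `G^j` by `p G^(j+1)`. Modulo `p` the degree stays at most `j`,
below `p - 1`, the first index where `p` can enter a Bernoulli denominator. -/
theorem diffDiv_bernoulliFunctional (h2 : p ≠ 2) {P G : ℤ[X]} (hP : P = 1 + (p : ℤ[X]) * G)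
    (hG : (G.map (Int.castRingHom (ZMod p))).natDegree ≤ 1) {M j : ℕ} (h : j + M < p - 1) :
    DiffDiv (pIntegral p) (p : ℚ) M
      fun s => bernoulliFunctional ((G ^ j * P ^ s).map (Int.castRingHom ℚ)) := by
  have hP1 : P.map (Int.castRingHom (ZMod p)) = 1 := by
    simp [hP]
  have hmem : ∀ j < p - 1, ∀ s,
      bernoulliFunctional ((G ^ j * P ^ s).map (Int.castRingHom ℚ)) ∈ pIntegral p := by
    refine fun j hj s => bernoulliFunctional_map_mem_pIntegral h2 (lt_of_le_of_lt ?_ hj)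
    rw [Polynomial.map_mul, Polynomial.map_pow, Polynomial.map_pow, hP1, one_pow, mul_one]
    exact (natDegree_pow_le_of_le j hG).trans (by simp)
  induction M generalizing j with
  | zero => exact hmem j h
  | succ M ih =>
    refine ⟨hmem j (by omega), _, ih (j := j + 1) (by omega), fun s => ?_⟩
    have hpow : G ^ j * P ^ (s + 1) - G ^ j * P ^ s = C (p : ℤ) * (G ^ (j + 1) * P ^ s) := by
      rw [show C (p : ℤ) = (p : ℤ[X]) by simp]
      linear_combination G ^ j * P ^ s * hP
    rw [← map_sub, ← Polynomial.map_sub, hpow, Polynomial.map_mul, map_C, ← smul_eq_C_mul,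
      map_smul, smul_eq_mul, eq_intCast, Int.cast_natCast]

variable (p) in
/-- The numbers `p (1 - p ^ (k - 1)) B_k` for `k = r (p - 1)`, with the natural value `p - 1` at
`r = 0`. -/
def eulerBernoulli (r : ℕ) : ℚ :=
  ∑ a ∈ Finset.Ico 1 p, bernoulliFunctional (((p : ℚ[X]) * X + (a : ℚ[X])) ^ (r * (p - 1)))

theorem diffDiv_eulerBernoulli (h2 : p ≠ 2) :
    DiffDiv (pIntegral p) (p : ℚ) (p - 2) (eulerBernoulli p) := by
  refine DiffDiv.sum _ fun a ha => ?_
  have ha' : ¬ p ∣ a := by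
    rw [Finset.mem_Ico] at ha
    exact Nat.not_dvd_of_pos_of_lt (by omega) ha.2
  obtain ⟨G, hG, hdeg⟩ := exists_pow_sub_one_eq_one_add_mul ha'
  have h := diffDiv_bernoulliFunctional h2 hG hdeg (M := p - 2) (j := 0)
    (by have := hp.out.two_le; omega)
  convert h using 3 with s
  simp [← pow_mul, mul_comm s]

theorem eulerBernoulli_zero : eulerBernoulli p 0 = p - 1 := by
  have : bernoulliFunctional 1 = 1 := by simpa using bernoulliFunctional_X_pow 0
  simp [eulerBernoulli, this, Nat.cast_sub hp.out.one_le]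

theorem eulerBernoulli_eq {r : ℕ} (hr : 0 < r) : eulerBernoulli p r
    = (1 - (p : ℚ) ^ (r * (p - 1) - 1)) * (p * bernoulli (r * (p - 1))) := by
  have h := sum_bernoulliFunctional_comp p (X ^ (r * (p - 1)))
  have hk : 0 < r * (p - 1) := Nat.mul_pos hr (by have := hp.out.two_le; omega)
  -- The term `a = 0` of the multiplication theorem becomes the removed Euler factor.
  rw [Finset.range_eq_Ico, Finset.sum_eq_sum_Ico_succ_bot hp.out.pos] at h
  have h0 : bernoulliFunctional (((p : ℚ[X]) * X) ^ (r * (p - 1)))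
      = (p : ℚ) ^ (r * (p - 1)) * bernoulli (r * (p - 1)) := by
    rw [mul_pow, ← C_eq_natCast, ← C_pow, ← smul_eq_C_mul, map_smul, bernoulliFunctional_X_pow,
      smul_eq_mul]
  simp only [X_pow_comp, Nat.cast_zero, add_zero, zero_add, h0, bernoulliFunctional_X_pow] at h
  rw [eulerBernoulli]
  have hpow : (p : ℚ) ^ (r * (p - 1)) = p ^ (r * (p - 1) - 1) * p := by
    rw [← pow_succ, Nat.sub_add_cancel hk]
  rw [hpow] at h
  linear_combination h

/-- Consecutive values agree modulo `p`, and the value at `0` is `p - 1`, so all are `≡ -1`. -/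
theorem eulerBernoulli_ne_zero_and_inv_mem (h3 : 3 ≤ p) (r : ℕ) :
    eulerBernoulli p r ≠ 0 ∧ (eulerBernoulli p r)⁻¹ ∈ pIntegral p := by
  have h : ∃ c ∈ pIntegral p, eulerBernoulli p r = -(1 + p * c) := by
    have hD := (diffDiv_eulerBernoulli (p := p) (by omega)).mono (show 1 ≤ p - 2 by omega)
    obtain ⟨-, g, hg, hfg⟩ := hD
    induction r with
    | zero =>
      exact ⟨-1, (pIntegral p).neg_mem (pIntegral p).one_mem, by rw [eulerBernoulli_zero]; ring⟩
    | succ r ih =>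
      obtain ⟨c, hc, hc'⟩ := ih
      exact ⟨c - g r, (pIntegral p).sub_mem hc (hg r), by linear_combination hfg r + hc'⟩
  obtain ⟨c, hc, h⟩ := h
  obtain ⟨h1, h2⟩ := one_add_mul_ne_zero_and_inv_mem hc
  rw [h, inv_neg]
  exact ⟨neg_ne_zero.2 h1, (pIntegral p).neg_mem h2⟩

theorem diffDiv_mul_inv_eulerBernoulli (h3 : 3 ≤ p) : DiffDiv (pIntegral p) (p : ℚ) (p - 1)
    fun r => p * (r * (eulerBernoulli p r)⁻¹) := by
  have h := ((diffDiv_eulerBernoulli (p := p) (by omega)).of_mul_eq_one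
    (fun r => (eulerBernoulli_ne_zero_and_inv_mem h3 r).2)
    (fun r => mul_inv_cancel₀ (eulerBernoulli_ne_zero_and_inv_mem h3 r).1)).natCast_mul
      (natCast_mem _ p)
  rwa [show p - 2 + 1 = p - 1 by omega] at h

end KummerCongruences

/-! ### Differences of the Eisenstein series. -/

section Eisenstein

open PowerSeries

variable {p : ℕ} [hp : Fact p.Prime]

theorem diffDiv_sum_divisors (n M : ℕ) : DiffDiv (pIntegral p) (p : ℚ) M
    fun r => ∑ d ∈ n.divisors with ¬ p ∣ d, (d : ℚ)⁻¹ * ((d : ℚ) ^ (p - 1)) ^ r := by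
  refine DiffDiv.sum _ fun d hd => ?_
  have hd : ¬ p ∣ d := (Finset.mem_filter.1 hd).2
  obtain ⟨c, hc⟩ : (p : ℤ) ∣ (d : ℤ) ^ (p - 1) - 1 := by
    rw [← ZMod.intCast_zmod_eq_zero_iff_dvd]
    push_cast
    rw [ZMod.pow_card_sub_one_eq_one (by rwa [Ne, ZMod.natCast_eq_zero_iff]), sub_self]
  have hc' : (d : ℚ) ^ (p - 1) - 1 = p * c := by exact_mod_cast hc
  exact (DiffDiv.const (inv_natCast_mem_pIntegral hd) M).mul (DiffDiv.pow
    ((pIntegral p).pow_mem (natCast_mem _ d) _) (intCast_mem _ c) (by linear_combination hc') M)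

/-- Both the Euler factor and the divisors divisible by `p` contribute errors divisible by
`p^(k-1)`, and `k - 1 ≥ p - 2`. -/
theorem exists_sum_divisors_eq {n r : ℕ} (h3 : 3 ≤ p) (hr : 0 < r) : ∃ c ∈ pIntegral p,
    (1 - (p : ℚ) ^ (r * (p - 1) - 1)) * (ArithmeticFunction.sigma (r * (p - 1) - 1) n : ℚ)
      - ∑ d ∈ n.divisors with ¬ p ∣ d, (d : ℚ)⁻¹ * ((d : ℚ) ^ (p - 1)) ^ r
      = (p : ℚ) ^ (p - 2) * c := by
  set R := pIntegral p
  have hk : 1 ≤ r * (p - 1) := Nat.mul_pos hr (by omega)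
  have hk' : p - 2 ≤ r * (p - 1) - 1 := by
    have := Nat.le_mul_of_pos_left (p - 1) hr
    omega
  have h1 : ∀ d ∈ n.divisors.filter (¬ p ∣ ·),
      (d : ℚ)⁻¹ * ((d : ℚ) ^ (p - 1)) ^ r = (d : ℚ) ^ (r * (p - 1) - 1) := fun d hd => by
    have hd0 : (d : ℚ) ≠ 0 := by
      have := (Finset.mem_filter.1 hd).2
      rintro h
      rw [Nat.cast_eq_zero] at h
      exact this (h ▸ dvd_zero p)
    rw [← pow_mul, mul_comm (p - 1), ← Nat.sub_add_cancel hk, pow_succ]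
    field_simp
    simp
  rw [Finset.sum_congr rfl h1, ArithmeticFunction.sigma_apply,
    ← Nat.sub_add_cancel hk', pow_add]
  have h2 := Finset.sum_filter_add_sum_filter_not n.divisors (p ∣ ·)
    (fun d : ℕ => (d : ℚ) ^ (r * (p - 1) - 1 - (p - 2) + (p - 2)))
  have h3 : ∃ c ∈ R, ∑ d ∈ n.divisors with p ∣ d,
      (d : ℚ) ^ (r * (p - 1) - 1 - (p - 2) + (p - 2)) = (p : ℚ) ^ (p - 2) * c := by
    refine ⟨∑ d ∈ n.divisors with p ∣ d,
      (d : ℚ) ^ (r * (p - 1) - 1 - (p - 2)) * ((d / p : ℕ) : ℚ) ^ (p - 2),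
      R.sum_mem fun d _ => R.mul_mem (R.pow_mem (natCast_mem _ _) _)
        (R.pow_mem (natCast_mem _ _) _), ?_⟩
    rw [Finset.mul_sum]
    refine Finset.sum_congr rfl fun d hd => ?_
    have : (d : ℚ) = p * (d / p : ℕ) := by
      exact_mod_cast (Nat.mul_div_cancel' (Finset.mem_filter.1 hd).2).symm
    rw [pow_add, mul_left_comm, ← mul_pow, ← this]
  obtain ⟨c, hc, h3⟩ := h3
  push_cast
  rw [← h2, h3]
  refine ⟨c - (p : ℚ) ^ (r * (p - 1) - 1 - (p - 2)) * ((p : ℚ) ^ (p - 2) * c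
    + ∑ d ∈ n.divisors with ¬ p ∣ d, (d : ℚ) ^ (r * (p - 1) - 1 - (p - 2) + (p - 2))), ?_, ?_⟩
  · exact R.sub_mem hc (R.mul_mem (R.pow_mem (natCast_mem _ _) _) (R.add_mem
      (R.mul_mem (R.pow_mem (natCast_mem _ _) _) hc)
      (R.sum_mem fun d _ => R.pow_mem (natCast_mem _ _) _)))
  · ring

theorem diffDiv_coeff_eisE (h3 : 3 ≤ p) (n : ℕ) :
    DiffDiv (pIntegral p) (p : ℚ) (p - 1) fun r => coeff n (eisE (r * (p - 1))) := by
  set R := pIntegral p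
  have hne : ∀ {r}, r ≠ 0 → r * (p - 1) ≠ 0 := fun hr => Nat.mul_ne_zero hr (by omega)
  rcases Nat.eq_zero_or_pos n with rfl | hn
  · convert! DiffDiv.const R.one_mem (p - 1) using 2 with r
    rcases eq_or_ne r 0 with rfl | hr
    · simp [eisE]
    · simp [eisE, hne hr, -coeff_zero_eq_constantCoeff]
  have hmain := (DiffDiv.const (R.mul_mem (R.neg_mem (natCast_mem R 2)) (natCast_mem R (p - 1)))
    (p - 1)).mul ((diffDiv_mul_inv_eulerBernoulli h3).mul (diffDiv_sum_divisors (p := p) n (p - 1)))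
  choose! c hc hc' using fun r => exists_sum_divisors_eq (p := p) (n := n) (r := r) h3
  -- The divisor-sum error `p^(p-2)` meets the factor `p` of `pr`. At `r = 0` the factor `r` kills
  -- the main term, matching `E_0 = 1`.
  have herr : DiffDiv R (p : ℚ) (p - 1) fun r => if r = 0 then 0 else
      (p : ℚ) ^ (p - 1) * (-2 * (p - 1 : ℕ) * (r * (eulerBernoulli p r)⁻¹) * c r) := by
    refine DiffDiv.of_pow_mul (natCast_mem R p) (g := fun r => if r = 0 then 0 else
      (-2 * (p - 1 : ℕ) * (r * (eulerBernoulli p r)⁻¹) * c r)) (fun r => ?_) (fun r => ?_)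
    · split_ifs with hr
      · exact R.zero_mem
      · exact R.mul_mem (R.mul_mem (R.mul_mem (R.neg_mem (natCast_mem R 2)) (natCast_mem R _))
          (R.mul_mem (natCast_mem R _) (eulerBernoulli_ne_zero_and_inv_mem h3 r).2))
          (hc r (Nat.pos_of_ne_zero hr))
    · split_ifs <;> simp
  convert! hmain.add herr using 2 with r
  rcases eq_or_ne r 0 with rfl | hr
  · simp [eisE, coeff_one, hn.ne']
  · simp only [eisE, hne hr, hn.ne', hr, if_false, coeff_mk]
    have h1 := hc' r (Nat.pos_of_ne_zero hr)
    have hC := (eulerBernoulli_ne_zero_and_inv_mem h3 r).1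
    have hE := eulerBernoulli_eq (p := p) (Nat.pos_of_ne_zero hr)
    have hB : bernoulli (r * (p - 1)) ≠ 0 := fun h => hC (by rw [hE, h]; simp)
    have hpp : (p : ℚ) ^ (p - 1) = p ^ (p - 2) * p := by
      rw [← pow_succ]
      congr 1
      omega
    have hinv : (bernoulli (r * (p - 1)))⁻¹
        = p * (1 - (p : ℚ) ^ (r * (p - 1) - 1)) * (eulerBernoulli p r)⁻¹ := by
      rw [inv_eq_one_div, div_eq_iff hB]
      field_simp
      linear_combination hE
    rw [div_eq_mul_inv, hinv, hpp]
    push_cast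
    linear_combination (-2 * ((p - 1 : ℕ) : ℚ) * (p * (r * (eulerBernoulli p r)⁻¹))) * h1

variable (p) in
/-- The ring `ℤ_(p)⟦q⟧` inside `ℚ⟦q⟧`. -/
def pIntegralSeries : Subring ℚ⟦X⟧ := (PowerSeries.map (pIntegral p).subtype).range

theorem mem_pIntegralSeries {f : ℚ⟦X⟧} :
    f ∈ pIntegralSeries p ↔ ∀ n, coeff n f ∈ pIntegral p := by
  constructor
  · rintro ⟨g, rfl⟩ n
    rw [coeff_map]
    exact (coeff n g).2
  · intro h
    exact ⟨PowerSeries.mk fun n => ⟨coeff n f, h n⟩, by ext n; simp⟩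

theorem exists_mul_eq_one_of_mem_pIntegralSeries {f : ℚ⟦X⟧} (hf : f ∈ pIntegralSeries p)
    (h1 : constantCoeff f = 1) : ∃ u ∈ pIntegralSeries p, f * u = 1 := by
  obtain ⟨g, rfl⟩ := hf
  have hg : constantCoeff g = 1 := by
    apply Subtype.ext
    rw [← coeff_zero_eq_constantCoeff_apply, coeff_map, coeff_zero_eq_constantCoeff_apply] at h1
    exact h1
  obtain ⟨v, hv⟩ := (PowerSeries.isUnit_iff_constantCoeff.2 (hg ▸ isUnit_one)).exists_right_inv
  exact ⟨_, ⟨v, rfl⟩, by rw [← map_mul, hv, map_one]⟩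

theorem coeff_natCast_pow_mul (q m n : ℕ) (f : ℚ⟦X⟧) :
    coeff n ((q : ℚ⟦X⟧) ^ m * f) = (q : ℚ) ^ m * coeff n f := by
  rw [← map_natCast (C (R := ℚ)), ← map_pow, coeff_C_mul]

theorem diffDiv_of_coeff {M : ℕ} {f : ℕ → ℚ⟦X⟧}
    (h : ∀ n, DiffDiv (pIntegral p) (p : ℚ) M fun s => coeff n (f s)) :
    DiffDiv (pIntegralSeries p) (p : ℚ⟦X⟧) M f := by
  induction M generalizing f with
  | zero => exact fun s => mem_pIntegralSeries.2 fun n => h n s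
  | succ M ih =>
    choose h1 g hg hfg using h
    refine ⟨fun s => mem_pIntegralSeries.2 fun n => h1 n s,
      fun s => PowerSeries.mk fun n => g n s, ih fun n => by simpa using hg n, fun s => ?_⟩
    ext n
    have := coeff_natCast_pow_mul p 1 n (PowerSeries.mk fun n => g n s)
    rw [pow_one, pow_one] at this
    rw [this, map_sub, hfg, coeff_mk]

theorem diffDiv_eisE (h3 : 3 ≤ p) : DiffDiv (pIntegralSeries p) (p : ℚ⟦X⟧) (p - 1)
    fun r => eisE (r * (p - 1)) :=
  diffDiv_of_coeff fun n => diffDiv_coeff_eisE h3 n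

theorem constantCoeff_eisE (k : ℕ) : constantCoeff (eisE k) = 1 := by
  rw [eisE]
  split_ifs
  · simp
  · rw [← coeff_zero_eq_constantCoeff_apply, coeff_mk, if_pos rfl]

theorem congMod_of_sub_eq {m : ℕ} {f g c : ℚ⟦X⟧} (hf : f ∈ pIntegralSeries p)
    (hc : c ∈ pIntegralSeries p) (h : f - g = (p : ℚ⟦X⟧) ^ m * c) : CongMod p m f g := by
  have hg : g ∈ pIntegralSeries p := by
    rw [show g = f - (p : ℚ⟦X⟧) ^ m * c by linear_combination -h]
    exact Subring.sub_mem _ hf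
      (Subring.mul_mem _ (Subring.pow_mem _ (natCast_mem _ p) m) hc)
  intro n
  refine ⟨mem_pIntegralSeries.1 hf n, mem_pIntegralSeries.1 hg n,
    coeff n c, mem_pIntegralSeries.1 hc n, ?_⟩
  rw [← map_sub, h, coeff_natCast_pow_mul]

end Eisenstein

end EisensteinCongruence

end

/-! ### The congruence for Eisenstein series. -/

theorem theorem1p2 (p m α : ℕ) (hp : p.Prime) (hp5 : 5 ≤ p)
    (hm : 1 ≤ m) (hmp : m ≤ p - 1) (hα : 1 ≤ α) :
    EisensteinCongruence.CongMod p m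
      (EisensteinCongruence.eisE (α * (p - 1)))
      (∑ r ∈ Finset.range m,
        EisensteinCongruence.H m α r •
          (EisensteinCongruence.eisE (r * (p - 1)) *
            EisensteinCongruence.eisE (p - 1) ^ (α - r))) := by
  open EisensteinCongruence in
  have : Fact p.Prime := ⟨hp⟩
  set R := pIntegralSeries p
  set E := eisE (p - 1) with hEdef
  have hE := diffDiv_eisE (p := p) (by omega)
  have hER : E ∈ R := by simpa using hE.mem 1
  obtain ⟨u, hu, hEu⟩ := exists_mul_eq_one_of_mem_pIntegralSeries hER (constantCoeff_eisE _)
  obtain ⟨-, g, hg, hg'⟩ := hE.mono (show 1 ≤ p - 1 by omega)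
  -- The first difference at `0` says `E_{p-1} = 1 + p g(0)`, since `E_0 = 1`.
  have hu1 : u = 1 + (p : PowerSeries ℚ) * (-(g 0 * u)) := by
    have h0 : eisE ((0 + 1) * (p - 1)) - eisE (0 * (p - 1)) = p * g 0 := hg' 0
    rw [zero_add, one_mul, zero_mul, ← hEdef, show eisE 0 = 1 by simp [eisE]] at h0
    linear_combination hEu - u * h0
  have hD := (hE.mul (DiffDiv.pow hu (R.neg_mem (R.mul_mem (hg 0) hu)) hu1 (p - 1))).mono hmp
  obtain ⟨c, hc, hsum⟩ := hD.eq_sum_H_smul α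
  refine congMod_of_sub_eq (hE.mem α) (R.mul_mem (R.pow_mem hER α) hc) ?_
  have hpow : E ^ α * u ^ α = 1 := by rw [← mul_pow, hEu, one_pow]
  have hterm : ∑ r ∈ Finset.range m, H m α r • (eisE (r * (p - 1)) * E ^ (α - r))
      = E ^ α * ∑ r ∈ Finset.range m, H m α r • (eisE (r * (p - 1)) * u ^ r) := by
    rw [Finset.mul_sum]
    refine Finset.sum_congr rfl fun r _ => ?_
    rcases lt_or_ge α r with h | h
    · simp [H_eq_zero_of_lt h]
    · have hr : E ^ r * u ^ r = 1 := by rw [← mul_pow, hEu, one_pow]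
      rw [mul_smul_comm]
      congr 1
      nth_rewrite 2 [← Nat.sub_add_cancel h]
      rw [pow_add]
      linear_combination (-(eisE (r * (p - 1)) * E ^ (α - r))) * hr
  rw [hterm]
  linear_combination E ^ α * hsum - eisE (α * (p - 1)) * hpow
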